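/- Let $p$ be a prime number, let $G$ be a profinite group and let $\theta\colon G\to\mathbb Z_p^\times$ be a continuous homomorphism. For $n\ge 1$ let $\mathbb Z/p^n\mathbb Z(1)$ be $\mathbb Z/p^n\mathbb Z$ with $G$ acting by multiplication via $\theta$. Suppose that $(G,\theta)$ satisfies formal Hilbert 90, i.e. for every open subgroup $U\subset G$ and every $n\geq 1$ the reduction map $H^1(U,\mathbb Z/p^n\mathbb Z(1))\to H^1(U,\mathbb Z/p\mathbb Z(1))$ on continuous cohomology is surjective. Let $\mathbb Z/2\mathbb Z$ carry the trivial action, let $\chi_1,\chi_2,\chi_3\in H^1(G,\mathbb Z/2\mathbb Z)=\operatorname{Hom}_{\mathrm{cont}}(G,\mathbb Z/2\mathbb Z)$ with $\chi_1\neq 0$, and let $H=\operatorname{Ker}(\chi_1)$, an open subgroup of $G$. Write $\operatorname{Res}$ for the restriction maps $H^i(G,\mathbb Z/2\mathbb Z)\to H^i(H,\mathbb Z/2\mathbb Z)$ and $\operatorname{Cor}$ for the corestriction map $H^1(H,\mathbb Z/2\mathbb Z)\to H^1(G,\mathbb Z/2\mathbb Z)$. For $a_1,\dots,a_n\in H^1(G,\mathbb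 Z/2\mathbb Z)$ with $n\ge 2$, a defining system is a family of continuous $1$-cochains $a_{ij}\colon G\to\mathbb Z/2\mathbb Z$, for $1\le i<j\le n+1$ and $(i,j)\ne(1,n+1)$, such that $a_{i,i+1}$ is a cocycle representing $a_i$ and $\partial a_{ij}=-\sum_{i<l<j}a_{il}\cup a_{lj}$ whenever $j>i+1$; here $(\partial a)(g,h)=a(h)-a(gh)+a(g)$ and $(a\cup b)(g,h)=a(g)b(h)$. Its value is the class of the $2$-cocycle $-\sum_{l=2}^{n}a_{1l}\cup a_{l,n+1}$ in $H^2(G,\mathbb Z/2\mathbb Z)$. The Massey product $\langle a_1,\dots,a_n\rangle\subset H^2(G,\mathbb Z/2\mathbb Z)$ is the set of values of all defining systems; it is defined if it is non-empty, and it vanishes if it contains $0$. (1) The Massey product $\langle\chi_1,\chi_2,\chi_3,\chi_1\rangle$ vanishes if and only if there exist $\varphi,\psi\in H^1(H,\mathbb Z/2\mathbb Z)$ such that $\operatorname{Cor}(\varphi)=\chi_2$, $\operatorname{Cor}(\psi)=\chi_3$, $\varphi\cup\psi=0$ and $\varphi\cup\operatorname{Res}(\chi_3)=0$ in $H^2(H,\mathbb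 Z/2\mathbb Z)$. (2) The Massey product $\langle\chi_1,\chi_2,\chi_3,\chi_1\rangle$ is defined if and only if there exist $\varphi,\psi\in H^1(H,\mathbb Z/2\mathbb Z)$ such that $\operatorname{Cor}(\varphi)=\chi_2$, $\operatorname{Cor}(\psi)=\chi_3$, $\varphi\cup\psi$ belongs to the image of $\operatorname{Res}\colon H^2(G,\mathbb Z/2\mathbb Z)\to H^2(H,\mathbb Z/2\mathbb Z)$ and $\varphi\cup\operatorname{Res}(\chi_3)=0$. -/

import Mathlib

/-! Low-degree continuous cohomology of a profinite group, computed by inhomogeneous continuous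
cochains; restriction, corestriction, cup products; Massey products of degree-one classes; and the
formal Hilbert 90 property of an oriented profinite group. -/

noncomputable section

set_option linter.unusedSectionVars false

namespace ContCoh

/-! ### Degree one, coefficients in a module -/

section DegreeOne

variable {G A B : Type*} [Group G] [TopologicalSpace G]
  [AddCommGroup A] [TopologicalSpace A] [IsTopologicalAddGroup A]
  [AddCommGroup B] [TopologicalSpace B] [IsTopologicalAddGroup B]

/-- Continuous inhomogeneous `1`-cocycles `Z¹(G, A)`, the action of `G` on `A` being `ρ`. -/
def Z1 (ρ : Representation ℤ G A) : AddSubgroup C(G, A) where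
  carrier := {f | ∀ g h, f (g * h) = f g + ρ g (f h)}
  zero_mem' := by intro g h; simp
  add_mem' := by
    intro a b ha hb g h
    simp only [ContinuousMap.add_apply, map_add, ha g h, hb g h]
    abel
  neg_mem' := by
    intro a ha g h
    simp only [ContinuousMap.neg_apply, map_neg, ha g h]
    abel

/-- `1`-coboundaries `B¹(G, A)`: the maps `g ↦ g • a - a`. -/
def B1 (ρ : Representation ℤ G A) : AddSubgroup C(G, A) where
  carrier := {f | ∃ a : A, ∀ g, f g = ρ g a - a}
  zero_mem' := ⟨0, by intro g; simp⟩
  add_mem' := by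
    rintro f f' ⟨a, ha⟩ ⟨b, hb⟩
    refine ⟨a + b, fun g => ?_⟩
    simp only [ContinuousMap.add_apply, map_add, ha g, hb g]
    abel
  neg_mem' := by
    rintro f ⟨a, ha⟩
    refine ⟨-a, fun g => ?_⟩
    simp only [ContinuousMap.neg_apply, map_neg, ha g]
    abel

/-- `H¹(G, A) = Z¹(G, A) / B¹(G, A)`. -/
abbrev H1 (ρ : Representation ℤ G A) : Type _ := Z1 ρ ⧸ (B1 ρ).addSubgroupOf (Z1 ρ)

/-- The map `H¹(G, A) → H¹(G, B)` induced by a continuous equivariant homomorphism `A → B`. -/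
def H1.mapCoeff {ρ : Representation ℤ G A} {σ : Representation ℤ G B} (φ : A →+ B)
    (hc : Continuous φ) (hφ : ∀ g a, φ (ρ g a) = σ g (φ a)) : H1 ρ →+ H1 σ :=
  QuotientAddGroup.map _ _
    { toFun := fun f => ⟨⟨fun g => φ (f.1 g), hc.comp f.1.continuous⟩, fun g h => by
        simp [f.2 g h, hφ]⟩
      map_zero' := by ext; simp
      map_add' := by intros; ext; simp }
    (by
      rintro ⟨f, hf⟩ ⟨a, ha⟩
      refine ⟨φ a, fun g => ?_⟩
      have := ha g
      simp only [AddSubgroup.subtype_apply] at this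
      simp [this, hφ])

end DegreeOne

/-! ### Trivial coefficients -/

section Trivial

variable (G A : Type*) [Group G] [TopologicalSpace G] [IsTopologicalGroup G]
  [AddCommGroup A] [TopologicalSpace A] [IsTopologicalAddGroup A]

/-- `H¹(G, A)` for the trivial action of `G` on `A`. -/
abbrev H1triv : Type _ := H1 (Representation.trivial ℤ G A)

/-- The differential `C¹(G, A) → C²(G, A)`, `(∂f)(g, h) = f h - f (g h) + f g`. -/
def d1 : C(G, A) →+ C(G × G, A) where
  toFun f := ⟨fun x => f x.2 - f (x.1 * x.2) + f x.1, by fun_prop⟩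
  map_zero' := by ext; simp
  map_add' := by intro f f'; ext x; simp; abel

/-- The differential `C²(G, A) → C³(G, A)`,
`(∂c)(g, h, k) = c (h, k) - c (g h, k) + c (g, h k) - c (g, h)`. -/
def d2 : C(G × G, A) →+ C(G × G × G, A) where
  toFun c := ⟨fun x => c (x.2.1, x.2.2) - c (x.1 * x.2.1, x.2.2) + c (x.1, x.2.1 * x.2.2)
    - c (x.1, x.2.1), by fun_prop⟩
  map_zero' := by ext; simp
  map_add' := by intro f f'; ext x; simp; abel

/-- `H²(G, A) = Z²(G, A) / B²(G, A)` for the trivial action of `G` on `A`. -/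
abbrev H2triv : Type _ := (d2 G A).ker ⧸ (d1 G A).range.addSubgroupOf (d2 G A).ker

variable {G A}

/-- A class in `H¹(G, A)`, trivial action, as the homomorphism `G → A` that it is. -/
def H1.eval : H1triv G A →+ C(G, A) :=
  QuotientAddGroup.lift _ (Z1 (Representation.trivial ℤ G A)).subtype (by
    rintro ⟨f, hf⟩ ⟨a, ha⟩
    ext g
    simpa using ha g)

theorem H1.eval_mul (χ : H1triv G A) (g h : G) : eval χ (g * h) = eval χ g + eval χ h := by
  induction χ using QuotientAddGroup.induction_on with
  | H f => exact f.2 g h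

/-- The kernel of a character with discrete target, an open subgroup. -/
def H1.ker [DiscreteTopology A] (χ : H1triv G A) : OpenSubgroup G where
  carrier := {g | eval χ g = 0}
  mul_mem' := by
    intro g h hg hh
    simp only [Set.mem_ofPred_eq] at *
    rw [eval_mul, hg, hh, add_zero]
  one_mem' := by
    have := eval_mul χ 1 1
    simpa using this
  inv_mem' := by
    intro g hg
    simp only [Set.mem_ofPred_eq] at *
    have h1 := eval_mul χ 1 1
    have h2 := eval_mul χ g g⁻¹
    simp only [mul_one, left_eq_add] at h1
    rw [mul_inv_cancel, h1, hg, zero_add] at h2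
    exact h2.symm
  isOpen' := (isOpen_discrete ({0} : Set A)).preimage (eval χ).continuous

variable (U : OpenSubgroup G)

/-- Restriction `H¹(G, A) → H¹(U, A)`. -/
def res1 : H1triv G A →+ H1triv U.toSubgroup A :=
  QuotientAddGroup.map _ _
    { toFun := fun f => ⟨⟨fun g => f.1 g, by fun_prop⟩, fun g h => f.2 g h⟩
      map_zero' := rfl
      map_add' := fun _ _ => rfl }
    (by
      rintro f ⟨a, ha⟩
      exact ⟨a, fun g => ha g⟩)

/-- Restriction `H²(G, A) → H²(U, A)`. -/
def res2 : H2triv G A →+ H2triv U.toSubgroup A :=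
  QuotientAddGroup.map _ _
    { toFun := fun c => ⟨⟨fun x => c.1 (x.1, x.2), by fun_prop⟩, by
        ext x
        exact DFunLike.congr_fun c.2 ((x.1 : G), (x.2.1 : G), (x.2.2 : G))⟩
      map_zero' := rfl
      map_add' := fun _ _ => rfl }
    (by
      rintro c ⟨f, hf⟩
      exact ⟨⟨fun g => f g, by fun_prop⟩, by
        ext x
        exact DFunLike.congr_fun hf ((x.1 : G), (x.2 : G))⟩)

/-- With `t` the chosen representatives of the left cosets of `U`, the element
`t(g q)⁻¹ g t(q)` of `U`. -/
def transferElt (g : G) (q : G ⧸ U.toSubgroup) : U.toSubgroup :=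
  ⟨(g • q).out⁻¹ * (g * q.out), by
    rw [← QuotientGroup.eq, QuotientGroup.out_eq', ← smul_eq_mul g, ← MulAction.Quotient.smul_mk,
      QuotientGroup.out_eq']⟩

theorem transferElt_mul (g h : G) (q : G ⧸ U.toSubgroup) :
    transferElt U (g * h) q = transferElt U g (h • q) * transferElt U h q := by
  ext
  simp [transferElt, mul_smul, mul_assoc]

theorem continuous_transferElt (q : G ⧸ U.toSubgroup) :
    Continuous fun g => transferElt U g q := by
  have : DiscreteTopology (G ⧸ U.toSubgroup) := QuotientGroup.discreteTopology U.isOpen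
  have h1 : Continuous fun g : G => g • q := by fun_prop
  have h2 : Continuous fun x : G ⧸ U.toSubgroup => x.out := continuous_of_discreteTopology
  exact Continuous.subtype_mk ((h2.comp h1).inv.mul (by fun_prop)) _

/-- Corestriction `H¹(U, A) → H¹(G, A)` for an open subgroup `U` of a compact group: on cocycles,
`(cor f)(g) = ∑ q ∈ G/U, f (t(g q)⁻¹ g t(q))`. -/
def cor1 [CompactSpace G] : H1triv U.toSubgroup A →+ H1triv G A :=
  haveI : Finite (G ⧸ U.toSubgroup) := Subgroup.quotient_finite_of_isOpen _ U.isOpen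
  letI := Fintype.ofFinite (G ⧸ U.toSubgroup)
  QuotientAddGroup.map _ _
    { toFun := fun f => ⟨⟨fun g => ∑ q : G ⧸ U.toSubgroup, f.1 (transferElt U g q),
          continuous_finsetSum _ fun q _ => f.1.continuous.comp (continuous_transferElt U q)⟩,
        fun g h => by
          have hf : ∀ a b, f.1 (a * b) = f.1 a + f.1 b := f.2
          simp only [ContinuousMap.coe_mk, transferElt_mul, hf, Finset.sum_add_distrib,
            Representation.trivial_apply]
          congr 1
          exact Fintype.sum_equiv (MulAction.toPerm h) _ _ fun _ => rfl⟩
      map_zero' := by ext; simp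
      map_add' := by intro f f'; ext; simp [Finset.sum_add_distrib] }
    (by
      rintro f ⟨a, ha⟩
      refine ⟨0, fun g => ?_⟩
      have h0 : ∀ u, f.1 u = 0 := fun u => by simpa using ha u
      simp [h0])

end Trivial

/-! ### Cup and Massey products -/

section Massey

variable {G R : Type*} [Group G] [TopologicalSpace G] [IsTopologicalGroup G]
  [CommRing R] [TopologicalSpace R] [IsTopologicalRing R]

/-- The cup product `C¹(G, R) × C¹(G, R) → C²(G, R)` of cochains (trivial action on `R`). -/
def cupC (a b : C(G, R)) : C(G × G, R) := ⟨fun x => a x.1 * b x.2, by fun_prop⟩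

/-- The cup product of two `1`-cocycles is a `2`-cocycle. -/
theorem cupC_mem (f f' : Z1 (Representation.trivial ℤ G R)) : cupC f.1 f'.1 ∈ (d2 G R).ker := by
  ext x
  have hf : ∀ a b, f.1 (a * b) = f.1 a + f.1 b := f.2
  have hf' : ∀ a b, f'.1 (a * b) = f'.1 a + f'.1 b := f'.2
  simp only [d2, cupC, AddMonoidHom.coe_mk, ZeroHom.coe_mk, ContinuousMap.coe_mk, hf, hf',
    ContinuousMap.zero_apply]
  ring

/-- The cup product `H¹(G, R) × H¹(G, R) → H²(G, R)`, the class of `f ∪ f'`. -/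
def cup : H1triv G R →+ H1triv G R →+ H2triv G R :=
  QuotientAddGroup.lift _
    { toFun := fun f => QuotientAddGroup.map _ _
        { toFun := fun f' => (⟨cupC f.1 f'.1, cupC_mem f f'⟩ : (d2 G R).ker)
          map_zero' := by ext; simp [cupC]
          map_add' := by intro a b; ext; simp [cupC, mul_add] }
        (by
          rintro f' ⟨a, ha⟩
          have h0 : ∀ g, f'.1 g = 0 := fun g => by simpa using ha g
          refine ⟨0, ?_⟩
          ext x
          simp [cupC, h0])
      map_zero' := by
        ext f'
        refine congrArg QuotientAddGroup.mk (Subtype.ext ?_)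
        ext x
        simp [cupC]
      map_add' := by
        intro a b
        ext f'
        refine congrArg QuotientAddGroup.mk (Subtype.ext ?_)
        ext x
        simp [cupC, add_mul] }
    (by
      rintro f ⟨a, ha⟩
      have h0 : ∀ g, f.1 g = 0 := fun g => by simpa using ha g
      ext f'
      refine congrArg QuotientAddGroup.mk (Subtype.ext ?_)
      ext x
      simp [cupC, h0])

/-- A defining system for the Massey product `⟨χ₀, …, χₙ₋₁⟩` in the differential graded ring of
continuous cochains, the matrix positions being numbered `0, …, n`. Only the entries `M i j` with
`i < j` and `(i, j) ≠ (0, n)` play a role. -/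
structure IsDefiningSystem {n : ℕ} (χ : Fin n → H1triv G R)
    (M : Fin (n + 1) → Fin (n + 1) → C(G, R)) : Prop where
  /-- `M i (i + 1)` is a cocycle that represents `χ i`. -/
  diag : ∀ i : Fin n, ∃ hz : M i.castSucc i.succ ∈ Z1 (Representation.trivial ℤ G R),
    QuotientAddGroup.mk (⟨M i.castSucc i.succ, hz⟩ : Z1 (Representation.trivial ℤ G R)) = χ i
  /-- `∂ (M i j) = - ∑ M i l ∪ M l j`, the sum over `i < l < j`. -/
  d_eq : ∀ i j : Fin (n + 1), i.val + 1 < j.val → (i, j) ≠ (0, Fin.last n) →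
    d1 G R (M i j) = -∑ l ∈ Finset.Ioo i j, cupC (M i l) (M l j)

/-- The cochain `-∑ M 0 l ∪ M l n`, the sum over `0 < l < n`. -/
def masseyCochain {n : ℕ} (M : Fin (n + 1) → Fin (n + 1) → C(G, R)) : C(G × G, R) :=
  -∑ l ∈ Finset.Ioo 0 (Fin.last n), cupC (M 0 l) (M l (Fin.last n))

theorem IsDefiningSystem.d_eq' {n : ℕ} {χ : Fin n → H1triv G R}
    {M : Fin (n + 1) → Fin (n + 1) → C(G, R)} (hM : IsDefiningSystem χ M) (i j : Fin (n + 1))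
    (hij : i < j) (h : (i, j) ≠ (0, Fin.last n)) :
    d1 G R (M i j) = -∑ l ∈ Finset.Ioo i j, cupC (M i l) (M l j) := by
  by_cases h1 : i.val + 1 < j.val
  · exact hM.d_eq i j h1 h
  · have h2 : j.val = i.val + 1 := by
      have : i.val < j.val := hij
      omega
    have hE : Finset.Ioo i j = ∅ := by
      ext l
      simp only [Finset.mem_Ioo, Fin.lt_def, Finset.notMem_empty, iff_false]
      omega
    rw [hE, Finset.sum_empty, neg_zero]
    have hin : i.val < n := by omega
    obtain ⟨hz, -⟩ := hM.diag ⟨i.val, hin⟩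
    have hi : (⟨i.val, hin⟩ : Fin n).castSucc = i := rfl
    have hj : (⟨i.val, hin⟩ : Fin n).succ = j := by ext; simp [h2]
    rw [hi, hj] at hz
    ext x
    have : M i j (x.1 * x.2) = M i j x.1 + M i j x.2 := hz x.1 x.2
    simp [d1, this]

theorem d2_cupC (a b : C(G, R)) (x : G × G × G) :
    d2 G R (cupC a b) x =
      d1 G R a (x.1, x.2.1) * b x.2.2 - a x.1 * d1 G R b (x.2.1, x.2.2) := by
  simp only [d2, d1, cupC, AddMonoidHom.coe_mk, ZeroHom.coe_mk, ContinuousMap.coe_mk]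
  ring

/-- The cochain of a defining system is a `2`-cocycle. -/
theorem IsDefiningSystem.masseyCochain_mem {n : ℕ} {χ : Fin n → H1triv G R}
    {M : Fin (n + 1) → Fin (n + 1) → C(G, R)} (hM : IsDefiningSystem χ M) :
    masseyCochain M ∈ (d2 G R).ker := by
  rw [AddMonoidHom.mem_ker, masseyCochain, map_neg, map_sum, neg_eq_zero]
  ext x
  rw [ContinuousMap.sum_apply]
  have h1 : ∀ l ∈ Finset.Ioo (0 : Fin (n + 1)) (Fin.last n),
      d2 G R (cupC (M 0 l) (M l (Fin.last n))) x =
        (∑ m ∈ Finset.Ioo l (Fin.last n), M 0 l x.1 * M l m x.2.1 * M m (Fin.last n) x.2.2)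
        - ∑ m ∈ Finset.Ioo 0 l, M 0 m x.1 * M m l x.2.1 * M l (Fin.last n) x.2.2 := by
    intro l hl
    rw [Finset.mem_Ioo] at hl
    rw [d2_cupC, hM.d_eq' 0 l hl.1 (by simp [hl.2.ne]),
      hM.d_eq' l (Fin.last n) hl.2 (by simp [hl.1.ne'])]
    simp only [ContinuousMap.neg_apply, ContinuousMap.sum_apply, cupC, ContinuousMap.coe_mk,
      neg_mul, mul_neg, Finset.sum_mul, Finset.mul_sum, mul_assoc]
    ring
  rw [Finset.sum_congr rfl h1, Finset.sum_sub_distrib, ContinuousMap.zero_apply, sub_eq_zero]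
  refine Finset.sum_comm' ?_
  intro l m
  simp only [Finset.mem_Ioo]
  constructor
  · rintro ⟨⟨a, b⟩, c, d⟩
    exact ⟨⟨a, c⟩, a.trans c, d⟩
  · rintro ⟨⟨a, b⟩, c, d⟩
    exact ⟨⟨a, b.trans d⟩, b, d⟩

/-- The Massey product `⟨χ₀, …, χₙ₋₁⟩ ⊆ H²(G, R)`: the set of values of all defining systems. -/
def masseyProduct {n : ℕ} (χ : Fin n → H1triv G R) : Set (H2triv G R) :=
  {c | ∃ (M : Fin (n + 1) → Fin (n + 1) → C(G, R)) (hM : IsDefiningSystem χ M),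
    c = QuotientAddGroup.mk (⟨masseyCochain M, hM.masseyCochain_mem⟩ : (d2 G R).ker)}

/-- The Massey product is defined. -/
def MasseyDefined {n : ℕ} (χ : Fin n → H1triv G R) : Prop := (masseyProduct χ).Nonempty

/-- The Massey product vanishes. -/
def MasseyVanishes {n : ℕ} (χ : Fin n → H1triv G R) : Prop := 0 ∈ masseyProduct χ

end Massey

/-! ### Oriented profinite groups -/

section Oriented

variable {p : ℕ} [Fact p.Prime] {G : Type*} [Group G] [TopologicalSpace G]

/-- The module `ℤ/pⁿ(1)`: `G` acts on `ℤ/pⁿ` by multiplication via `θ`. -/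
def twist (θ : G →ₜ* ℤ_[p]ˣ) (n : ℕ) : Representation ℤ G (ZMod (p ^ n)) where
  toFun g := LinearMap.mulLeft ℤ (PadicInt.toZModPow n (θ g : ℤ_[p]))
  map_one' := by ext; simp
  map_mul' g h := by ext; simp

/-- The reduction map `H¹(U, ℤ/pⁿ(1)) → H¹(U, ℤ/p(1))`, for `n ≥ 1`. -/
def reduction (θ : G →ₜ* ℤ_[p]ˣ) (U : OpenSubgroup G) (n : ℕ) (hn : 1 ≤ n) :
    H1 ((twist θ n).comp U.toSubgroup.subtype) →+ H1 ((twist θ 1).comp U.toSubgroup.subtype) :=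
  H1.mapCoeff (ZMod.castHom (pow_dvd_pow p hn) (ZMod (p ^ 1))).toAddMonoidHom
    continuous_of_discreteTopology (by
      intro g a
      change ZMod.castHom (pow_dvd_pow p hn) (ZMod (p ^ 1))
          (PadicInt.toZModPow n (θ g.1 : ℤ_[p]) * a) =
        PadicInt.toZModPow 1 (θ g.1 : ℤ_[p]) * ZMod.castHom (pow_dvd_pow p hn) (ZMod (p ^ 1)) a
      rw [map_mul, ← PadicInt.zmod_cast_comp_toZModPow 1 n hn]
      rfl)

/-- `(G, θ)` satisfies formal Hilbert 90. -/
def FormalHilbert90 (θ : G →ₜ* ℤ_[p]ˣ) : Prop :=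
  ∀ (U : OpenSubgroup G) (n : ℕ) (hn : 1 ≤ n), Function.Surjective (reduction θ U n hn)

end Oriented

end ContCoh

end

/-!
Let `H = Ker χ₁`, of index two, and let `E` be the free `ℤ/2`-module with basis `G/H`, on which `G`
acts through `χ₁`. The argument is Shapiro's lemma for `E`.

A relation `∂a = χ₁ ∪ χ₂` says that `(a, χ₂)` is a `1`-cocycle with values in
`E`, where `g` acts by the unipotent matrix with off-diagonal entry `χ₁ g`. By Shapiro's lemma such
cocycles correspond to `φ ∈ H¹(H)`, the restriction of `a`, and then `χ₂ = Cor φ`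
(`exists_extension`, `cor1_eq_of_extension`). In the same way a relation `∂e = χ₃ ∪ χ₁` corresponds
to `ψ ∈ H¹(H)` with `Cor ψ = χ₃`; passing from a left to a right factor `χ₁` changes `e` by the
product `χ₁ χ₃`, which vanishes on `H`.

Fix `a`, `e` and a class `α ∈ H²(G)`. The rest of a defining system for `⟨χ₁, χ₂, χ₃, χ₁⟩` with
value `α` consists of the upper right `2 × 2` block of a unipotent `5 × 5` matrix. Restricting its
first row to `H`, where `χ₁` vanishes, gives `φ ∪ Res χ₃ = 0` and `φ ∪ ψ = Res α`. Conversely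
each column of the block is a trivialization of a `2`-cocycle with values in `E`, and by the
injectivity of `H²(G, E) → H²(H, ℤ/2)` (`exists_eq_of_res_eq`) it exists as soon as its upper entry
can be solved over `H`. Hence `α` lies in the Massey product if and only if there are `φ`, `ψ` with
`Cor φ = χ₂`, `Cor ψ = χ₃`, `φ ∪ ψ = Res α` and `φ ∪ Res χ₃ = 0` (`mem_masseyProduct_iff`). Taking
`α = 0` gives the criterion for vanishing, and letting `α` vary the one for being defined.

As signs do not matter modulo two, the equation `∂f = c` is written throughout as
`f (g h) = f g + f h + c (g, h)`.
-/

namespace ContCoh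

/-! ### Classes in degree one, and their cup products -/

theorem H1.eval_injective {G A : Type*} [Group G] [TopologicalSpace G] [AddCommGroup A]
    [TopologicalSpace A] [IsTopologicalAddGroup A] :
    Function.Injective (H1.eval : H1triv G A → C(G, A)) := by
  rw [injective_iff_map_eq_zero]
  intro χ h
  induction χ using QuotientAddGroup.induction_on with
  | H f =>
    refine (QuotientAddGroup.eq_zero_iff _).2 ⟨0, fun g => ?_⟩
    have h0 : f.1 g = 0 := DFunLike.congr_fun h g
    simpa using h0

section Classes

variable {G : Type*} [Group G] [TopologicalSpace G]

theorem exists_eval_eq {A : Type*} [AddCommGroup A] [TopologicalSpace A] [IsTopologicalAddGroup A]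
    (f : C(G, A)) (hf : ∀ g h, f (g * h) = f g + f h) : ∃ χ : H1triv G A, H1.eval χ = f :=
  ⟨QuotientAddGroup.mk ⟨f, hf⟩, rfl⟩

theorem eval_res1 {A : Type*} [AddCommGroup A] [TopologicalSpace A] [IsTopologicalAddGroup A]
    (U : OpenSubgroup G) (χ : H1triv G A) (u : U.toSubgroup) :
    H1.eval (res1 U χ) u = H1.eval χ u := by
  induction χ using QuotientAddGroup.induction_on with
  | H f => rfl

theorem exists_eval_eq_one {χ : H1triv G (ZMod 2)} (hχ : χ ≠ 0) : ∃ τ, H1.eval χ τ = 1 := by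
  by_contra! h
  refine hχ (H1.eval_injective ?_)
  ext g
  have : ∀ x : ZMod 2, x ≠ 1 → x = 0 := by decide
  simpa using this _ (h g)

variable [IsTopologicalGroup G]

theorem eval_one {A : Type*} [AddCommGroup A] [TopologicalSpace A] [IsTopologicalAddGroup A]
    (χ : H1triv G A) : H1.eval χ 1 = 0 := by
  simpa using H1.eval_mul χ 1 1

theorem eval_cor1 {A : Type*} [AddCommGroup A] [TopologicalSpace A] [IsTopologicalAddGroup A]
    [CompactSpace G] (U : OpenSubgroup G) [Fintype (G ⧸ U.toSubgroup)]
    (φ : H1triv U.toSubgroup A) (g : G) :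
    H1.eval (cor1 U φ) g = ∑ q : G ⧸ U.toSubgroup, H1.eval φ (transferElt U g q) := by
  induction φ using QuotientAddGroup.induction_on with
  | H f =>
    have : Finite (G ⧸ U.toSubgroup) := Subgroup.quotient_finite_of_isOpen _ U.isOpen
    have h : H1.eval (cor1 U (f : H1triv U.toSubgroup A)) g =
        (@Finset.sum _ _ _ (@Finset.univ _ (Fintype.ofFinite (G ⧸ U.toSubgroup)))
          fun q => f.1 (transferElt U g q)) := rfl
    rw [h]
    exact Finset.sum_congr (by ext; simp) fun _ _ => rfl

theorem d1_eq_iff (f : C(G, ZMod 2)) (c : C(G × G, ZMod 2)) :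
    d1 G (ZMod 2) f = c ↔ ∀ g h, f (g * h) = f g + f h + c (g, h) := by
  constructor
  · intro hf g h
    have : f h - f (g * h) + f g = c (g, h) := DFunLike.congr_fun hf (g, h)
    grind
  · intro hf
    ext ⟨g, h⟩
    change f h - f (g * h) + f g = c (g, h)
    have := hf g h
    grind

theorem cup_eq_mk_iff (φ ψ : H1triv G (ZMod 2)) (c : (d2 G (ZMod 2)).ker) :
    cup φ ψ = QuotientAddGroup.mk c ↔
      ∃ v : C(G, ZMod 2), ∀ g h,
        v (g * h) = v g + v h + (H1.eval φ g * H1.eval ψ h + c.1 (g, h)) := by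
  induction φ using QuotientAddGroup.induction_on with
  | H f =>
  induction ψ using QuotientAddGroup.induction_on with
  | H f' =>
    change (QuotientAddGroup.mk (⟨cupC f.1 f'.1, cupC_mem f f'⟩ : (d2 G (ZMod 2)).ker) :
      H2triv G (ZMod 2)) = _ ↔ _
    rw [QuotientAddGroup.eq]
    refine exists_congr fun v => (d1_eq_iff _ _).trans ?_
    refine forall₂_congr fun g h => ?_
    change _ = _ + (-(f.1 g * f'.1 h) + c.1 (g, h)) ↔ _
    rw [CharTwo.neg_eq]
    rfl

end Classes

/-! ### Degree-two Shapiro lemma for the kernel of a character -/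

/-- A homogeneous `2`-cocycle `Ψ` on a set `X` is a coboundary as soon as its pullback along a
self-map `r` of `X` is: the prism operator is a homotopy between the identity and `r`. -/
theorem prism {X : Type*} (Ψ : X → X → X → ZMod 2) (V : X → X → ZMod 2) (r : X → X)
    (hΨ : ∀ a b c d, Ψ b c d + Ψ a c d + Ψ a b d + Ψ a b c = 0)
    (hV : ∀ a b c, V (r b) (r c) + V (r a) (r c) + V (r a) (r b) = Ψ (r a) (r b) (r c))
    (W : X → X → ZMod 2) (hW : ∀ a b, W a b = Ψ (r a) a b + Ψ (r a) (r b) b + V (r a) (r b))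
    (a b c : X) : W b c + W a c + W a b = Ψ a b c := by
  have h1 := hΨ (r a) a b c
  have h2 := hΨ (r a) (r b) b c
  have h3 := hΨ (r a) (r b) (r c) c
  have h4 := hV a b c
  simp only [hW]
  grind

section IndexTwo

variable {G : Type*} [Group G] [TopologicalSpace G] [IsTopologicalGroup G]
  {χ : H1triv G (ZMod 2)}

theorem eval_inv (χ : H1triv G (ZMod 2)) (g : G) : H1.eval χ g⁻¹ = H1.eval χ g := by
  have h := H1.eval_mul χ g g⁻¹
  rw [mul_inv_cancel, eval_one] at h
  grind

/-- The retraction `G → H` onto `H = Ker χ` that sends `h` and `h τ`, for `h ∈ H`, to `h`, where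
`χ τ = 1`. It commutes with left multiplication by `H`. -/
def retract {τ : G} (hτ : H1.eval χ τ = 1) : C(G, (H1.ker χ).toSubgroup) where
  toFun g := ⟨g * (if H1.eval χ g = 0 then 1 else τ⁻¹), by
    change H1.eval χ _ = 0
    split_ifs with h
    · simpa using h
    · rw [H1.eval_mul, eval_inv, hτ]
      generalize H1.eval χ g = x at *
      revert x; decide⟩
  continuous_toFun := by
    have h2 : Continuous fun x : ZMod 2 => if x = 0 then (1 : G) else τ⁻¹ :=
      continuous_of_discreteTopology
    exact Continuous.subtype_mk (continuous_id.mul (h2.comp (H1.eval χ).continuous)) _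

variable {τ : G} (hτ : H1.eval χ τ = 1)

theorem retract_of_eq_zero {g : G} (hg : H1.eval χ g = 0) : (retract hτ g : G) = g := by
  simp [retract, hg]

theorem retract_of_eq_one {g : G} (hg : H1.eval χ g = 1) : (retract hτ g : G) = g * τ⁻¹ := by
  simp [retract, hg]

theorem retract_coe (u : (H1.ker χ).toSubgroup) : retract hτ (u : G) = u :=
  Subtype.ext (retract_of_eq_zero hτ u.2)

theorem retract_mul_left {h : G} (hh : H1.eval χ h = 0) (g : G) :
    (retract hτ (h * g) : G) = h * retract hτ g := by
  simp [retract, H1.eval_mul, hh, mul_assoc]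

theorem eval_retract (g : G) : H1.eval χ (retract hτ g : G) = 0 := (retract hτ g).2

/-- Injectivity in Shapiro's lemma in degree two. Let `g ∈ G` act on `E = (ℤ/2)²` by
`g (p, q) = (p + χ g * q, q)`, which is the module induced from the trivial module of
`H = Ker χ`. The hypotheses say that `(P, Q)` is a `2`-cocycle with values in `E` whose first
coordinate is a coboundary on `H`; then `(P, Q)` is the coboundary of `(x, y)`. -/
theorem exists_eq_of_res_eq (hχ : χ ≠ 0) (P Q : C(G × G, ZMod 2))
    (hQ : ∀ g h k, Q (h, k) + Q (g * h, k) + Q (g, h * k) + Q (g, h) = 0)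
    (hP : ∀ g h k, P (h, k) + P (g * h, k) + P (g, h * k) + P (g, h) = H1.eval χ g * Q (h, k))
    (v : C((H1.ker χ).toSubgroup, ZMod 2))
    (hv : ∀ g h : (H1.ker χ).toSubgroup, v (g * h) = v g + v h + P (g, h)) :
    ∃ x y : C(G, ZMod 2), (∀ g h, y (g * h) = y g + y h + Q (g, h)) ∧
      ∀ g h, x (g * h) = x g + x h + (H1.eval χ g * y h + P (g, h)) := by
  obtain ⟨τ, hτ⟩ := exists_eval_eq_one hχ
  let r : C(G, G) := ⟨fun g => retract hτ g, continuous_subtype_val.comp (retract hτ).continuous⟩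
  have hr0 : ∀ g, H1.eval χ (r g) = 0 := eval_retract hτ
  -- The homogeneous cochain of `(P, Q)`, of which only the first coordinate is kept. It is
  -- invariant under `H`, and it determines the second coordinate, as `τ (p, q)` has first coordinate `p + q`.
  let Ψ : G → G → G → ZMod 2 := fun a b c =>
    P (a⁻¹ * b, b⁻¹ * c) + H1.eval χ a * Q (a⁻¹ * b, b⁻¹ * c)
  let V : G → G → ZMod 2 := fun a b => v (retract hτ (a⁻¹ * b))
  let W : G → G → ZMod 2 := fun a b => Ψ (r a) a b + Ψ (r a) (r b) b + V (r a) (r b)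
  have hW : ∀ a b c, W b c + W a c + W a b = Ψ a b c := by
    refine prism Ψ V r ?_ ?_ W fun _ _ => rfl
    · intro a b c d
      have h1 := hP (a⁻¹ * b) (b⁻¹ * c) (c⁻¹ * d)
      have h2 := hQ (a⁻¹ * b) (b⁻¹ * c) (c⁻¹ * d)
      simp only [mul_assoc, mul_inv_cancel_left, H1.eval_mul, eval_inv] at h1 h2
      simp only [Ψ]
      grind
    · intro a b c
      have key : ∀ a b, H1.eval χ ((r a)⁻¹ * r b) = 0 := fun a b => by
        rw [H1.eval_mul, eval_inv, hr0, hr0, add_zero]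
      have h1 := hv ⟨_, key a b⟩ ⟨_, key b c⟩
      have h2 : ∀ a b, V (r a) (r b) = v ⟨_, key a b⟩ := fun a b =>
        congrArg v (Subtype.ext (retract_of_eq_zero hτ (key a b)))
      have h3 : (⟨_, key a b⟩ * ⟨_, key b c⟩ : (H1.ker χ).toSubgroup) = ⟨_, key a c⟩ :=
        Subtype.ext (by simp [mul_assoc])
      rw [h3] at h1
      rw [h2, h2, h2, h1]
      simp only [Ψ, hr0, zero_mul, add_zero]
      grind
  -- `W a b` is invariant under left multiplication by `H`.
  have hinv : ∀ h a b, H1.eval χ h = 0 → W (h * a) (h * b) = W a b := by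
    intro h a b hh
    have h1 : ∀ g, r (h * g) = h * r g := retract_mul_left hτ hh
    simp only [W, Ψ, V, h1, H1.eval_mul, hh, zero_add, mul_inv_rev, mul_assoc, inv_mul_cancel_left]
  have hinv' : ∀ g g' a b, H1.eval χ g = H1.eval χ g' →
      W (g * a) (g * b) = W (g' * a) (g' * b) := by
    intro g g' a b hg
    have h1 := hinv (g * g'⁻¹) (g' * a) (g' * b) (by
      rw [H1.eval_mul, eval_inv, hg, CharTwo.add_self_eq_zero])
    simpa [mul_assoc] using h1
  have hc : ∀ a : G, Continuous fun g => W a (a * g) := by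
    intro a
    simp only [W, Ψ, V]
    fun_prop
  have h01 : ∀ z : ZMod 2, z = 0 ∨ z = 1 := by decide
  refine ⟨⟨fun g => W 1 (1 * g), hc 1⟩, ⟨fun g => W 1 (1 * g) + W τ (τ * g), (hc 1).add (hc τ)⟩,
    fun g h => ?_, fun g h => ?_⟩
  · have h1 := hW 1 g (g * h)
    have h2 := hW τ (τ * g) (τ * g * h)
    simp only [Ψ, eval_one, hτ, inv_one, one_mul, inv_mul_cancel_left, mul_inv_rev,
      mul_assoc, zero_mul, add_zero] at h1 h2
    simp only [ContinuousMap.coe_mk, one_mul]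
    rcases h01 (H1.eval χ g) with hg | hg
    · have h3 := hinv' g 1 1 h (by rw [hg, eval_one])
      have h4 := hinv' (τ * g) τ 1 h (by rw [H1.eval_mul, hg, add_zero])
      simp only [mul_one, one_mul, mul_assoc] at h3 h4
      grind
    · have h3 := hinv' g τ 1 h (by rw [hg, hτ])
      have h4 := hinv' (τ * g) 1 1 h (by rw [H1.eval_mul, hg, hτ, eval_one]; rfl)
      simp only [mul_one, one_mul, mul_assoc] at h3 h4
      grind
  · have h1 := hW 1 g (g * h)
    simp only [Ψ, eval_one, inv_one, one_mul, inv_mul_cancel_left, zero_mul, add_zero] at h1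
    simp only [ContinuousMap.coe_mk, one_mul]
    rcases h01 (H1.eval χ g) with hg | hg
    · have h3 := hinv' g 1 1 h (by rw [hg, eval_one])
      simp only [mul_one, one_mul] at h3
      grind
    · have h3 := hinv' g τ 1 h (by rw [hg, hτ])
      simp only [mul_one] at h3
      grind

variable [CompactSpace G]

/-! ### Corestriction and extension of cocycles -/

/-- The corestriction from `H = Ker χ`, with the cosets of `H` indexed by the values of `χ`, and
`s z` the chosen representative of the coset with value `z`. -/
theorem exists_section_cor1 (hχ : χ ≠ 0) : ∃ s : ZMod 2 → G, ∃ hs : ∀ z, H1.eval χ (s z) = z,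
    ∀ (φ : H1triv (H1.ker χ).toSubgroup (ZMod 2)) (g : G), H1.eval (cor1 (H1.ker χ) φ) g =
      ∑ z, H1.eval φ ⟨(s (H1.eval χ g + z))⁻¹ * (g * s z), by
        change H1.eval χ _ = 0
        rw [H1.eval_mul, eval_inv, H1.eval_mul, hs, hs, CharTwo.add_self_eq_zero]⟩ := by
  obtain ⟨τ, hτ⟩ := exists_eval_eq_one hχ
  have : Finite (G ⧸ (H1.ker χ).toSubgroup) :=
    Subgroup.quotient_finite_of_isOpen _ (H1.ker χ).isOpen
  have := Fintype.ofFinite (G ⧸ (H1.ker χ).toSubgroup)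
  have hmk : ∀ a b : G, (a : G ⧸ (H1.ker χ).toSubgroup) = b ↔ H1.eval χ a = H1.eval χ b := by
    intro a b
    rw [QuotientGroup.eq]
    change H1.eval χ _ = 0 ↔ _
    rw [H1.eval_mul, eval_inv, CharTwo.add_eq_zero]
  have hout : ∀ g : G, H1.eval χ (g : G ⧸ (H1.ker χ).toSubgroup).out = H1.eval χ g := fun g =>
    (hmk _ _).1 (QuotientGroup.out_eq' _)
  let e : G ⧸ (H1.ker χ).toSubgroup → ZMod 2 := fun q => H1.eval χ q.out
  have he : Function.Bijective e := by
    constructor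
    · intro q q' h
      rw [← QuotientGroup.out_eq' q, ← QuotientGroup.out_eq' q']
      exact (hmk _ _).2 h
    · intro z
      have h01 : ∀ z : ZMod 2, z = 0 ∨ z = 1 := by decide
      rcases h01 z with rfl | rfl
      · exact ⟨((1 : G) : G ⧸ (H1.ker χ).toSubgroup), (hout 1).trans (eval_one χ)⟩
      · exact ⟨(τ : G ⧸ (H1.ker χ).toSubgroup), (hout τ).trans hτ⟩
  let E := Equiv.ofBijective e he
  have hsmul : ∀ (g : G) (q : G ⧸ (H1.ker χ).toSubgroup), E (g • q) = H1.eval χ g + E q := by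
    intro g q
    induction q using QuotientGroup.induction_on with
    | H x => exact (hout (g * x)).trans ((H1.eval_mul χ g x).trans (congrArg _ (hout x).symm))
  refine ⟨fun z => (E.symm z).out, fun z => E.apply_symm_apply z, fun φ g => ?_⟩
  rw [eval_cor1]
  refine Fintype.sum_equiv E _ _ fun q => congrArg _ (Subtype.ext ?_)
  simp [transferElt, ← hsmul]

/-- A cocycle `φ` on `H = Ker χ` extends to a cochain `a` on `G` with `∂a = χ ∪ Cor φ`. -/
theorem exists_extension (hχ : χ ≠ 0) (φ : H1triv (H1.ker χ).toSubgroup (ZMod 2)) :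
    ∃ a : C(G, ZMod 2), (∀ u : (H1.ker χ).toSubgroup, a u = H1.eval φ u) ∧
      ∀ g h, a (g * h) = a g + a h + H1.eval χ g * H1.eval (cor1 (H1.ker χ) φ) h := by
  obtain ⟨s, hs, hcor⟩ := exists_section_cor1 hχ
  have hτ : H1.eval χ (s 1) = 1 := hs 1
  have hφ := H1.eval_mul φ
  refine ⟨(H1.eval φ).comp (retract hτ), fun u => congrArg _ (retract_coe hτ u), ?_⟩
  let a : C(G, ZMod 2) := (H1.eval φ).comp (retract hτ)
  change ∀ g h, a (g * h) = a g + a h + _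
  have ha : ∀ g (hg : g ∈ (H1.ker χ).toSubgroup), a g = H1.eval φ ⟨g, hg⟩ := fun g hg =>
    congrArg _ (retract_coe hτ ⟨g, hg⟩)
  have hleft : ∀ h g, H1.eval χ h = 0 → a (h * g) = a h + a g := by
    intro h g hh
    rw [ha h hh]
    change H1.eval φ _ = _ + H1.eval φ _
    rw [← hφ]
    exact congrArg _ (Subtype.ext (retract_mul_left hτ hh g))
  have hcor' : ∀ g, H1.eval (cor1 (H1.ker χ) φ) g =
      ∑ z, a ((s (H1.eval χ g + z))⁻¹ * (g * s z)) := by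
    intro g
    rw [hcor]
    exact Finset.sum_congr rfl fun z _ => (ha _ _).symm
  have h01 : ∀ z : ZMod 2, z = 0 ∨ z = 1 := by decide
  have h11 : (1 + 1 : ZMod 2) = 0 := rfl
  have ha1 : a 1 = 0 := (ha 1 (one_mem _)).trans (eval_one φ)
  have haτ : a (s 1) = 0 := by
    have : retract hτ (s 1) = 1 := Subtype.ext (by simp [retract_of_eq_one hτ hτ])
    change H1.eval φ _ = 0
    rw [this, eval_one]
  have hainv : ∀ g, H1.eval χ g = 0 → a g⁻¹ = a g := by
    intro g hg
    have := hleft g g⁻¹ hg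
    rw [mul_inv_cancel, ha1] at this
    grind
  -- The case `g = s 1` of the claim, to which left equivariance reduces the others.
  have key : ∀ h, a (s 1 * h) = a h + H1.eval (cor1 (H1.ker χ) φ) h := by
    intro h
    have hsum : ∀ f : ZMod 2 → ZMod 2, ∑ z, f z = f 0 + f 1 := Fin.sum_univ_two
    rw [hcor', hsum]
    rcases h01 (H1.eval χ h) with hh | hh
    · have h1 := hleft (s 0)⁻¹ (h * s 0) (by rw [eval_inv, hs])
      have h2 := hleft h (s 0) hh
      have hm : H1.eval χ (s 1 * s 1) = 0 := by rw [H1.eval_mul, hs, h11]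
      have hk : H1.eval χ ((s 1)⁻¹ * (h * s 1)) = 0 := by
        rw [H1.eval_mul, H1.eval_mul, eval_inv, hs, hh, zero_add, h11]
      have h3 := hleft _ ((s 1)⁻¹ * (h * s 1) * ((s 1 * s 1)⁻¹ * s 1)) hm
      have h4 := hleft _ ((s 1 * s 1)⁻¹ * s 1) hk
      have h5 := hleft (s 1 * s 1)⁻¹ (s 1) (by rw [eval_inv, hm])
      have h6 : s 1 * s 1 * ((s 1)⁻¹ * (h * s 1) * ((s 1 * s 1)⁻¹ * s 1)) = s 1 * h := by group
      have h7 := hainv _ hm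
      have h8 := hainv _ (hs 0)
      rw [h6] at h3
      rw [hh, zero_add, zero_add]
      grind
    · have hk : H1.eval χ ((s 1)⁻¹ * h) = 0 := by rw [H1.eval_mul, eval_inv, hs, hh, h11]
      have hk' : H1.eval χ (h * (s 1)⁻¹) = 0 := by rw [H1.eval_mul, eval_inv, hs, hh, h11]
      have hm : H1.eval χ (s 1 * s 1) = 0 := by rw [H1.eval_mul, hs, h11]
      have h1 := hleft _ (s 0) hk
      have h2 := hleft (s 0)⁻¹ (h * s 1) (by rw [eval_inv, hs])
      have h3 := hleft _ (s 1 * s 1) hk'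
      have h4 := hleft _ (s 1) hk'
      have h5 := hleft _ ((s 1)⁻¹ * h) hm
      have h6 := hainv _ (hs 0)
      have h7 : h * (s 1)⁻¹ * (s 1 * s 1) = h * s 1 := by group
      have h8 : s 1 * s 1 * ((s 1)⁻¹ * h) = s 1 * h := by group
      rw [h7] at h3
      rw [inv_mul_cancel_right] at h4
      rw [h8] at h5
      rw [mul_assoc] at h1
      rw [hh, add_zero, h11]
      grind
  intro g h
  rcases h01 (H1.eval χ g) with hg | hg
  · rw [hleft g h hg, hg, zero_mul, add_zero]
  · have hk : H1.eval χ (g * (s 1)⁻¹) = 0 := by rw [H1.eval_mul, eval_inv, hg, hs, h11]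
    have h1 := hleft _ (s 1 * h) hk
    have h2 := hleft _ (s 1) hk
    rw [mul_assoc, inv_mul_cancel_left] at h1
    rw [inv_mul_cancel_right] at h2
    rw [h1, h2, key, hg, haτ]
    ring

/-- Conversely, if `φ` extends to a cochain `a` on `G` with `∂a = χ ∪ β`, then `β = Cor φ`.
The difference of `a` and the extension of `exists_extension` vanishes on `H` and is constant off
`H`, because it satisfies such a relation with `β - Cor φ` in place of `β`. -/
theorem cor1_eq_of_extension (hχ : χ ≠ 0) (φ : H1triv (H1.ker χ).toSubgroup (ZMod 2))
    (β : H1triv G (ZMod 2)) (a : G → ZMod 2)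
    (ha : ∀ u : (H1.ker χ).toSubgroup, a u = H1.eval φ u)
    (hmul : ∀ g h, a (g * h) = a g + a h + H1.eval χ g * H1.eval β h) :
    cor1 (H1.ker χ) φ = β := by
  obtain ⟨τ, hτ⟩ := exists_eval_eq_one hχ
  obtain ⟨a', ha', hmul'⟩ := exists_extension hχ φ
  refine H1.eval_injective ?_
  ext h
  have h0 : ∀ g, H1.eval χ g = 0 → a g = a' g := fun g hg => (ha ⟨g, hg⟩).trans (ha' ⟨g, hg⟩).symm
  have h01 : ∀ z : ZMod 2, z = 0 ∨ z = 1 := by decide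
  have h1 : ∀ g, H1.eval χ g = 1 → a g + a' g = a τ + a' τ := by
    intro g hg
    have hk : H1.eval χ (g * τ⁻¹) = 0 := by rw [H1.eval_mul, eval_inv, hg, hτ]; rfl
    have h2 := hmul (g * τ⁻¹) τ
    have h3 := hmul' (g * τ⁻¹) τ
    rw [inv_mul_cancel_right, hk] at h2 h3
    have := h0 _ hk
    grind
  have h2 := hmul τ h
  have h3 := hmul' τ h
  rw [hτ] at h2 h3
  rcases h01 (H1.eval χ h) with hh | hh
  · have h4 := h1 (τ * h) (by rw [H1.eval_mul, hτ, hh, add_zero])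
    have h5 := h0 h hh
    grind
  · have h4 := h0 (τ * h) (by rw [H1.eval_mul, hτ, hh]; rfl)
    have h5 := h1 h hh
    grind

end IndexTwo

/-! ### Defining systems of fourfold Massey products -/

section Massey
variable {G : Type*} [Group G] [TopologicalSpace G] [IsTopologicalGroup G]

theorem exists_mk_eq_iff {A : Type*} [AddCommGroup A] [TopologicalSpace A]
    [IsTopologicalAddGroup A] (f : C(G, A)) (χ : H1triv G A) :
    (∃ hz : f ∈ Z1 (Representation.trivial ℤ G A),
      QuotientAddGroup.mk (⟨f, hz⟩ : Z1 (Representation.trivial ℤ G A)) = χ) ↔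
      f = H1.eval χ := by
  constructor
  · rintro ⟨hz, rfl⟩
    rfl
  · rintro rfl
    exact ⟨H1.eval_mul χ, H1.eval_injective rfl⟩

/-- In characteristic two, `∂e = γ ∪ β` implies `∂(e + β γ) = β ∪ γ`, as
`∂(β γ) = β ∪ γ + γ ∪ β`. -/
theorem mul_eq_of_add_mul (β γ : H1triv G (ZMod 2)) (e : C(G, ZMod 2))
    (he : ∀ g h, e (g * h) = e g + e h + H1.eval β h * H1.eval γ g) (g h : G) :
    (e + H1.eval β * H1.eval γ : C(G, ZMod 2)) (g * h) =
      (e + H1.eval β * H1.eval γ : C(G, ZMod 2)) g +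
        (e + H1.eval β * H1.eval γ : C(G, ZMod 2)) h + H1.eval β g * H1.eval γ h := by
  simp only [ContinuousMap.add_apply, ContinuousMap.mul_apply, he, H1.eval_mul]
  grind

variable (χ₁ χ₂ χ₃ : H1triv G (ZMod 2))

theorem isDefiningSystem_iff (M : Fin 5 → Fin 5 → C(G, ZMod 2)) :
    IsDefiningSystem ![χ₁, χ₂, χ₃, χ₁] M ↔
      (M 0 1 = H1.eval χ₁ ∧ M 1 2 = H1.eval χ₂ ∧ M 2 3 = H1.eval χ₃ ∧ M 3 4 = H1.eval χ₁) ∧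
      (∀ g h, M 0 2 (g * h) = M 0 2 g + M 0 2 h + M 0 1 g * M 1 2 h) ∧
      (∀ g h, M 1 3 (g * h) = M 1 3 g + M 1 3 h + M 1 2 g * M 2 3 h) ∧
      (∀ g h, M 2 4 (g * h) = M 2 4 g + M 2 4 h + M 2 3 g * M 3 4 h) ∧
      (∀ g h, M 0 3 (g * h) = M 0 3 g + M 0 3 h + (M 0 1 g * M 1 3 h + M 0 2 g * M 2 3 h)) ∧
      (∀ g h, M 1 4 (g * h) = M 1 4 g + M 1 4 h + (M 1 2 g * M 2 4 h + M 1 3 g * M 3 4 h)) := by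
  have h02 : Finset.Ioo (0 : Fin 5) 2 = {1} := by decide
  have h13 : Finset.Ioo (1 : Fin 5) 3 = {2} := by decide
  have h24 : Finset.Ioo (2 : Fin 5) 4 = {3} := by decide
  have h03 : Finset.Ioo (0 : Fin 5) 3 = {1, 2} := by decide
  have h14 : Finset.Ioo (1 : Fin 5) 4 = {2, 3} := by decide
  have n : ∀ x : ZMod 2, -x = x := by decide
  have key : ∀ i j : Fin 5, d1 G (ZMod 2) (M i j) = -∑ l ∈ Finset.Ioo i j, cupC (M i l) (M l j) ↔
      ∀ g h, M i j (g * h) = M i j g + M i j h + ∑ l ∈ Finset.Ioo i j, M i l g * M l j h := by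
    intro i j
    rw [d1_eq_iff]
    simp only [ContinuousMap.neg_apply, ContinuousMap.sum_apply, n]
    rfl
  constructor
  · rintro ⟨hd, he⟩
    simp only [exists_mk_eq_iff] at hd
    have h1 := (key 0 2).1 (he 0 2 (by decide) (by decide))
    have h2 := (key 1 3).1 (he 1 3 (by decide) (by decide))
    have h3 := (key 2 4).1 (he 2 4 (by decide) (by decide))
    have h4 := (key 0 3).1 (he 0 3 (by decide) (by decide))
    have h5 := (key 1 4).1 (he 1 4 (by decide) (by decide))
    simp only [h02, h13, h24, h03, h14, Finset.sum_singleton,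
      Finset.sum_pair (show (1 : Fin 5) ≠ 2 by decide),
      Finset.sum_pair (show (2 : Fin 5) ≠ 3 by decide)] at h1 h2 h3 h4 h5
    exact ⟨⟨hd 0, hd 1, hd 2, hd 3⟩, h1, h2, h3, h4, h5⟩
  · rintro ⟨⟨d0, d1, d2, d3⟩, h1, h2, h3, h4, h5⟩
    refine ⟨fun i => (exists_mk_eq_iff _ _).2 ?_, fun i j hij hne => (key i j).2 ?_⟩
    · fin_cases i
      exacts [d0, d1, d2, d3]
    · fin_cases i <;> fin_cases j <;> first
        | exact absurd hij (by decide)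
        | exact absurd rfl hne
        | skip
      · simpa [h02] using h1
      · simpa [h03] using h4
      · simpa [h13] using h2
      · simpa [h14] using h5
      · simpa [h24] using h3

/-- The entries of a defining system above the first diagonal are named
`(0,2) = a`, `(0,3) = x`, `(1,3) = y`, `(2,4) = e`, `(1,4) = w`, and `z` is a cochain in the corner
`(0,4)` that witnesses that the value is the class of `α`. -/
theorem mk_mem_masseyProduct_iff (α : (d2 G (ZMod 2)).ker) :
    (QuotientAddGroup.mk α : H2triv G (ZMod 2)) ∈ masseyProduct ![χ₁, χ₂, χ₃, χ₁] ↔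
      ∃ a x y e w z : C(G, ZMod 2),
        (∀ g h, a (g * h) = a g + a h + H1.eval χ₁ g * H1.eval χ₂ h) ∧
        (∀ g h, y (g * h) = y g + y h + H1.eval χ₂ g * H1.eval χ₃ h) ∧
        (∀ g h, e (g * h) = e g + e h + H1.eval χ₃ g * H1.eval χ₁ h) ∧
        (∀ g h, x (g * h) = x g + x h + (H1.eval χ₁ g * y h + a g * H1.eval χ₃ h)) ∧
        (∀ g h, w (g * h) = w g + w h + (H1.eval χ₂ g * e h + y g * H1.eval χ₁ h)) ∧
        (∀ g h, z (g * h) = z g + z h +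
          (H1.eval χ₁ g * w h + a g * e h + x g * H1.eval χ₁ h + α.1 (g, h))) := by
  have h04 : Finset.Ioo (0 : Fin 5) (Fin.last 4) = {1, 2, 3} := by decide
  have hm : ∀ (M : Fin 5 → Fin 5 → C(G, ZMod 2)) (z : C(G, ZMod 2)),
      d1 G (ZMod 2) z = -masseyCochain M + α.1 ↔ ∀ g h, z (g * h) = z g + z h +
        (M 0 1 g * M 1 4 h + M 0 2 g * M 2 4 h + M 0 3 g * M 3 4 h + α.1 (g, h)) := by
    intro M z
    refine (d1_eq_iff _ _).trans (forall₂_congr fun g h => ?_)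
    rw [ContinuousMap.add_apply, masseyCochain, neg_neg, h04, ContinuousMap.sum_apply,
      Finset.sum_insert (by decide), Finset.sum_pair (by decide), ← add_assoc (cupC _ _ _)]
    rfl
  constructor
  · rintro ⟨M, hM, h⟩
    obtain ⟨z, hz⟩ := QuotientAddGroup.eq.1 h.symm
    replace hz := (hm M z).1 hz
    rw [isDefiningSystem_iff] at hM
    obtain ⟨⟨d0, d1, d2, d3⟩, h02, h13, h24, h03, h14⟩ := hM
    simp only [d0, d1, d2, d3] at hz h02 h13 h24 h03 h14
    exact ⟨M 0 2, M 0 3, M 1 3, M 2 4, M 1 4, z, h02, h13, h24, h03, h14, hz⟩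
  · rintro ⟨a, x, y, e, w, z, ha, hy, he, hx, hw, hz⟩
    let M : Fin 5 → Fin 5 → C(G, ZMod 2) :=
      ![![0, H1.eval χ₁, a, x, 0], ![0, 0, H1.eval χ₂, y, w], ![0, 0, 0, H1.eval χ₃, e],
        ![0, 0, 0, 0, H1.eval χ₁], ![0, 0, 0, 0, 0]]
    refine ⟨M, (isDefiningSystem_iff _ _ _ M).2 ⟨⟨rfl, rfl, rfl, rfl⟩, ha, hy, he, hx, hw⟩, ?_⟩
    symm
    exact QuotientAddGroup.eq.2 ⟨z, (hm M z).2 hz⟩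

variable {χ₁}

/-- Given the entries `a` and `e`, the remaining ones exist if the first row can be solved over
`H = Ker χ₁`. -/
theorem exists_cochains_of_res (hχ : χ₁ ≠ 0) (α : (d2 G (ZMod 2)).ker) (a e : C(G, ZMod 2))
    (hma : ∀ g h, a (g * h) = a g + a h + H1.eval χ₁ g * H1.eval χ₂ h)
    (hme : ∀ g h, e (g * h) = e g + e h + H1.eval χ₃ g * H1.eval χ₁ h)
    (u v : C((H1.ker χ₁).toSubgroup, ZMod 2))
    (hu : ∀ g h, u (g * h) = u g + u h + a g * H1.eval χ₃ h)
    (hv : ∀ g h, v (g * h) = v g + v h + (a g * e h + α.1 ((g : G), (h : G)))) :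
    ∃ x y w z : C(G, ZMod 2),
      (∀ g h, y (g * h) = y g + y h + H1.eval χ₂ g * H1.eval χ₃ h) ∧
      (∀ g h, x (g * h) = x g + x h + (H1.eval χ₁ g * y h + a g * H1.eval χ₃ h)) ∧
      (∀ g h, w (g * h) = w g + w h + (H1.eval χ₂ g * e h + y g * H1.eval χ₁ h)) ∧
      (∀ g h, z (g * h) = z g + z h +
        (H1.eval χ₁ g * w h + a g * e h + x g * H1.eval χ₁ h + α.1 (g, h))) := by
  have hα : ∀ g h k, α.1 (h, k) + α.1 (g * h, k) + α.1 (g, h * k) + α.1 (g, h) = 0 := by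
    intro g h k
    have : α.1 (h, k) - α.1 (g * h, k) + α.1 (g, h * k) - α.1 (g, h) = 0 :=
      DFunLike.congr_fun α.2 (g, h, k)
    simpa only [CharTwo.sub_eq_add] using this
  -- The column `(x, y)` comes first, as it enters the equations for the column `(z, w)`.
  obtain ⟨x, y, hy, hx⟩ := exists_eq_of_res_eq hχ (cupC a (H1.eval χ₃))
    (cupC (H1.eval χ₂) (H1.eval χ₃))
    (fun g h k => by simp only [cupC, ContinuousMap.coe_mk, H1.eval_mul]; grind)
    (fun g h k => by simp only [cupC, ContinuousMap.coe_mk, H1.eval_mul, hma]; grind)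
    u hu
  simp only [cupC, ContinuousMap.coe_mk] at hx hy
  obtain ⟨z, w, hw, hz⟩ := exists_eq_of_res_eq hχ
    (cupC a e + cupC x (H1.eval χ₁) + α.1)
    (cupC (H1.eval χ₂) e + cupC y (H1.eval χ₁))
    (fun g h k => by
      simp only [cupC, ContinuousMap.coe_mk, ContinuousMap.add_apply, H1.eval_mul, hme, hy]
      grind)
    (fun g h k => by
      have := hα g h k
      simp only [cupC, ContinuousMap.coe_mk, ContinuousMap.add_apply, H1.eval_mul, hme, hma, hx]
      grind)
    v (fun g h => by
      have hh : H1.eval χ₁ (h : G) = 0 := h.2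
      simp only [cupC, ContinuousMap.coe_mk, ContinuousMap.add_apply, hh, mul_zero, add_zero]
      exact hv g h)
  refine ⟨x, y, w, z, hy, hx, hw, fun g h => (hz g h).trans ?_⟩
  simp only [cupC, ContinuousMap.coe_mk, ContinuousMap.add_apply, add_assoc]

/-- The values of the Massey product, described over the kernel of `χ₁`. -/
theorem mem_masseyProduct_iff [CompactSpace G] (hχ : χ₁ ≠ 0) (α : H2triv G (ZMod 2)) :
    α ∈ masseyProduct ![χ₁, χ₂, χ₃, χ₁] ↔
      ∃ φ ψ : H1triv (H1.ker χ₁).toSubgroup (ZMod 2),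
        cor1 (H1.ker χ₁) φ = χ₂ ∧ cor1 (H1.ker χ₁) ψ = χ₃ ∧
        cup φ ψ = res2 (H1.ker χ₁) α ∧ cup φ (res1 (H1.ker χ₁) χ₃) = 0 := by
  induction α using QuotientAddGroup.induction_on with
  | H α =>
  have hres : ∀ φ ψ : H1triv (H1.ker χ₁).toSubgroup (ZMod 2),
      cup φ ψ = res2 (H1.ker χ₁) (QuotientAddGroup.mk α) ↔
        ∃ v : C((H1.ker χ₁).toSubgroup, ZMod 2), ∀ g h, v (g * h) = v g + v h +
          (H1.eval φ g * H1.eval ψ h + α.1 ((g : G), (h : G))) := fun φ ψ => cup_eq_mk_iff φ ψ _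
  have hzero : ∀ φ ψ : H1triv (H1.ker χ₁).toSubgroup (ZMod 2), cup φ ψ = 0 ↔
        ∃ v : C((H1.ker χ₁).toSubgroup, ZMod 2), ∀ g h, v (g * h) = v g + v h +
          (H1.eval φ g * H1.eval ψ h + 0) := fun φ ψ => cup_eq_mk_iff φ ψ 0
  have hker : ∀ u : (H1.ker χ₁).toSubgroup, H1.eval χ₁ (u : G) = 0 := fun u => u.2
  simp only [hres, hzero, eval_res1, add_zero]
  rw [mk_mem_masseyProduct_iff]
  constructor
  · rintro ⟨a, x, y, e, w, z, ha, -, he, hx, -, hz⟩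
    obtain ⟨φ, hφ⟩ := exists_eval_eq (G := (H1.ker χ₁).toSubgroup)
      ⟨fun u => a u, a.continuous.comp continuous_subtype_val⟩ fun g h =>
        (ha g h).trans (by rw [hker, zero_mul, add_zero]; rfl)
    obtain ⟨ψ, hψ⟩ := exists_eval_eq (G := (H1.ker χ₁).toSubgroup)
      ⟨fun u => e u, e.continuous.comp continuous_subtype_val⟩ fun g h =>
        (he g h).trans (by rw [hker, mul_zero, add_zero]; rfl)
    have hφ' : ∀ u, H1.eval φ u = a u := fun u => DFunLike.congr_fun hφ u
    have hψ' : ∀ u, H1.eval ψ u = e u := fun u => DFunLike.congr_fun hψ u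
    refine ⟨φ, ψ, cor1_eq_of_extension hχ φ χ₂ a (fun u => (hφ' u).symm) ha,
      cor1_eq_of_extension hχ ψ χ₃ (e + H1.eval χ₁ * H1.eval χ₃ : C(G, ZMod 2))
        (fun u => ?_) (mul_eq_of_add_mul χ₁ χ₃ e fun g h => ?_),
      ⟨⟨fun u => z u, z.continuous.comp continuous_subtype_val⟩, fun g h => ?_⟩,
      ⟨⟨fun u => x u, x.continuous.comp continuous_subtype_val⟩, fun g h => ?_⟩⟩
    · rw [ContinuousMap.add_apply, ContinuousMap.mul_apply, hker, hψ', zero_mul, add_zero]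
    · rw [he, mul_comm]
    · have := hz g h
      rw [hker, hker, zero_mul, mul_zero, zero_add, add_zero] at this
      rw [hφ', hψ']
      exact this
    · have := hx g h
      rw [hker, zero_mul, zero_add] at this
      rw [hφ']
      exact this
  · rintro ⟨φ, ψ, rfl, rfl, ⟨v, hv⟩, u, hu⟩
    obtain ⟨a, ha, hma⟩ := exists_extension hχ φ
    obtain ⟨e, he, hme⟩ := exists_extension hχ ψ
    have hme' := mul_eq_of_add_mul (cor1 (H1.ker χ₁) ψ) χ₁ e fun g h => by
      rw [hme, mul_comm]
    obtain ⟨x, y, w, z, hy, hx, hw, hz⟩ := exists_cochains_of_res _ _ hχ α a _ hma hme' u v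
      (fun g h => by rw [ha]; exact hu g h)
      (fun g h => by
        rw [ha, ContinuousMap.add_apply, ContinuousMap.mul_apply, hker h, he, mul_zero, add_zero]
        exact hv g h)
    exact ⟨a, x, y, _, w, z, hma, hy, hme', hx, hw, hz⟩

end Massey

end ContCoh

theorem proposition7p1 (p : ℕ) [Fact p.Prime] (G : Type*) [Group G] [TopologicalSpace G]
    [IsTopologicalGroup G] [CompactSpace G] [T2Space G] [TotallyDisconnectedSpace G]
    (θ : G →ₜ* ℤ_[p]ˣ) (hθ : ContCoh.FormalHilbert90 θ)
    (χ₁ χ₂ χ₃ : ContCoh.H1triv G (ZMod 2)) (hχ₁ : χ₁ ≠ 0)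
    (H : OpenSubgroup G) (hH : H = ContCoh.H1.ker χ₁) :
    (ContCoh.MasseyVanishes ![χ₁, χ₂, χ₃, χ₁] ↔
      ∃ φ ψ : ContCoh.H1triv H.toSubgroup (ZMod 2),
        ContCoh.cor1 H φ = χ₂ ∧ ContCoh.cor1 H ψ = χ₃ ∧
        ContCoh.cup φ ψ = 0 ∧ ContCoh.cup φ (ContCoh.res1 H χ₃) = 0) ∧
    (ContCoh.MasseyDefined ![χ₁, χ₂, χ₃, χ₁] ↔
      ∃ φ ψ : ContCoh.H1triv H.toSubgroup (ZMod 2),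
        ContCoh.cor1 H φ = χ₂ ∧ ContCoh.cor1 H ψ = χ₃ ∧
        ContCoh.cup φ ψ ∈ Set.range (ContCoh.res2 (A := ZMod 2) H) ∧
        ContCoh.cup φ (ContCoh.res1 H χ₃) = 0) := by
  subst hH
  constructor
  · rw [ContCoh.MasseyVanishes, ContCoh.mem_masseyProduct_iff χ₂ χ₃ hχ₁, map_zero]
  · simp only [ContCoh.MasseyDefined, Set.Nonempty, ContCoh.mem_masseyProduct_iff χ₂ χ₃ hχ₁]
    constructor
    · rintro ⟨α, φ, ψ, h2, h3, h, h'⟩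
      exact ⟨φ, ψ, h2, h3, ⟨α, h.symm⟩, h'⟩
    · rintro ⟨φ, ψ, h2, h3, ⟨α, h⟩, h'⟩
      exact ⟨α, φ, ψ, h2, h3, h.symm, h'⟩
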